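/- **Corollary (Non-existence of strict bad local minima).** Consider a fully connected feed-forward network with $H\ge 0$ hidden layers, input dimension $d_0$, hidden widths $d_1,\dots,d_H$, output dimension $d_{H+1}$ and activation function $\sigma:\mathbb{R}\to\mathbb{R}$. For data matrices $X\in\mathbb{R}^{d_0\times N}$, $Y\in\mathbb{R}^{d_{H+1}\times N}$ (one column per training sample) and weights $W=(W_1,\dots,W_{H+1})$ with $W_i\in\mathbb{R}^{d_i\times d_{i-1}}$, put $$T_0=X,\qquad T_i=\Phi(W_iT_{i-1})\quad(1\le i\le H),\qquad T_{H+1}=W_{H+1}T_H,$$ where $\Phi$ applies $\sigma$ to each entry of a matrix, and let $E(W)=l(Y,T_{H+1})$ be the empirical loss, where $l:\mathbb{R}^{d_{H+1}\times N}\times\mathbb{R}^{d_{H+1}\times N}\to\mathbb{R}$. Suppose that 1. there is a $k$ such that $X_{ki}\ne X_{kj}$ for all $i\neq j$; 2. $\hat Y\mapsto l(Y,\hat Y)$ is convex and continuous on $\mathbb{R}^{d_{H+1}\times N}$; 3. $d_H\ge N$; 4. $\sigma$ is continuous. Then $E$ has no strict bad local minimum: there is no $W$ such that $E(W)<E(W')$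 for all $W'\neq W$ in some neighbourhood of $W$ and $E(W)>\inf_{W'}E(W')$ (where the infimum may be $-\infty$). -/

import Mathlib

open Filter Topology

noncomputable section

namespace DeepNet

/-- The weights `(W₁, …, W_{H+1})` of a fully connected network with `H` hidden layers, where
`d 0` is the input dimension, `d 1, …, d H` are the hidden widths and `d (H + 1)` is the output
dimension. The matrix `W_{i+1}`, from layer `i` to layer `i + 1`, has index `i`. -/
abbrev Weights {H : ℕ} (d : Fin (H + 2) → ℕ) : Type :=
  (i : Fin (H + 1)) → Matrix (Fin (d i.succ)) (Fin (d i.castSucc)) ℝ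

/-- The output matrices of the layers `0, …, H`: `T₀ = X` and `T_{i+1} = Φ(W_{i+1} T_i)`, where
`Φ` applies the activation function `σ` to each entry. -/
def layerOutput {H N : ℕ} (d : Fin (H + 2) → ℕ) (σ : ℝ → ℝ)
    (X : Matrix (Fin (d 0)) (Fin N) ℝ) (W : Weights d) (i : Fin (H + 1)) :
    Matrix (Fin (d i.castSucc)) (Fin N) ℝ :=
  Fin.induction (motive := fun i : Fin (H + 1) => Matrix (Fin (d i.castSucc)) (Fin N) ℝ)
    X (fun i T => (W i.castSucc * T).map σ) i

/-- The network output `T_{H+1} = W_{H+1} T_H`. -/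
def networkOutput {H N : ℕ} (d : Fin (H + 2) → ℕ) (σ : ℝ → ℝ)
    (X : Matrix (Fin (d 0)) (Fin N) ℝ) (W : Weights d) :
    Matrix (Fin (d (Fin.last (H + 1)))) (Fin N) ℝ :=
  W (Fin.last H) * layerOutput d σ X W (Fin.last H)

/-- The empirical loss `E(W) = l(Y, T_{H+1})`. -/
def empiricalLoss {H N : ℕ} (d : Fin (H + 2) → ℕ) (σ : ℝ → ℝ)
    (l : Matrix (Fin (d (Fin.last (H + 1)))) (Fin N) ℝ →
      Matrix (Fin (d (Fin.last (H + 1)))) (Fin N) ℝ → ℝ)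
    (X : Matrix (Fin (d 0)) (Fin N) ℝ) (Y : Matrix (Fin (d (Fin.last (H + 1)))) (Fin N) ℝ)
    (W : Weights d) : ℝ :=
  l Y (networkOutput d σ X W)

/-- `x` is a strict local minimum of `f`: `f x < f y` for all `y ≠ x` close enough to `x`. -/
def IsStrictLocalMin {S : Type*} [TopologicalSpace S] (f : S → ℝ) (x : S) : Prop :=
  ∀ᶠ y in 𝓝[≠] x, f x < f y

/-- A strict local minimum is bad if its value is above the global infimum. The infimum is taken
in the extended reals, so that it is `-∞` when `f` is unbounded below. -/
def IsStrictBadLocalMin {S : Type*} [TopologicalSpace S] (f : S → ℝ) (x : S) : Prop :=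
  IsStrictLocalMin f x ∧ (⨅ y, (f y : EReal)) < (f x : EReal)

end DeepNet

end

/-! Freeze all weights but the last matrix `R`: the loss becomes the convex `l Y` composed with the
linear map `R ↦ R * T_H`. A strict local minimum stays strict on this slice, so the linear map has
no kernel; as `d_H ≥ N`, it is then bijective. Convexity makes the local minimum global on the
slice, and surjectivity makes it a minimum of `l Y` over all matrices, hence over all network
outputs. -/

open DeepNet in
theorem layerOutput_succ {H N : ℕ} (d : Fin (H + 2) → ℕ) (σ : ℝ → ℝ)
    (X : Matrix (Fin (d 0)) (Fin N) ℝ) (W : Weights d) (i : Fin H) :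
    layerOutput d σ X W i.succ = (W i.castSucc * layerOutput d σ X W i.castSucc).map σ :=
  rfl

open DeepNet in
/-- The outputs of the layers up to the last hidden one do not depend on the last weight matrix. -/
theorem layerOutput_update_last {H N : ℕ} (d : Fin (H + 2) → ℕ) (σ : ℝ → ℝ)
    (X : Matrix (Fin (d 0)) (Fin N) ℝ) (W : Weights d)
    (R : Matrix (Fin (d (Fin.last H).succ)) (Fin (d (Fin.last H).castSucc)) ℝ)
    (i : Fin (H + 1)) :
    layerOutput d σ X (Function.update W (Fin.last H) R) i = layerOutput d σ X W i := by
  induction i using Fin.induction with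
  | zero => rfl
  | succ i ih =>
    rw [layerOutput_succ, layerOutput_succ, ih,
      Function.update_of_ne (Fin.castSucc_lt_last i).ne]

open DeepNet in
theorem networkOutput_update_last {H N : ℕ} (d : Fin (H + 2) → ℕ) (σ : ℝ → ℝ)
    (X : Matrix (Fin (d 0)) (Fin N) ℝ) (W : Weights d)
    (R : Matrix (Fin (d (Fin.last H).succ)) (Fin (d (Fin.last H).castSucc)) ℝ) :
    networkOutput d σ X (Function.update W (Fin.last H) R) =
      R * layerOutput d σ X W (Fin.last H) := by
  unfold networkOutput
  rw [layerOutput_update_last, Function.update_self]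

/-- A function that factors through a linear map has no strict local minimum unless the linear map
is injective. -/
theorem DeepNet.IsStrictLocalMin.injective_of_comp_linearMap {V V' : Type*} [AddCommGroup V]
    [Module ℝ V] [TopologicalSpace V] [ContinuousAdd V] [ContinuousSMul ℝ V] [AddCommGroup V']
    [Module ℝ V'] {g : V' → ℝ} {L : V →ₗ[ℝ] V'} {x : V}
    (h : DeepNet.IsStrictLocalMin (g ∘ L) x) : Function.Injective L := by
  rw [injective_iff_map_eq_zero]
  intro v hv
  by_contra hv0
  -- Along a kernel direction `v` the function is constant, which contradicts strictness.
  have hline : Tendsto (fun t : ℝ => x + t • v) (𝓝[≠] 0) (𝓝[≠] x) := by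
    refine tendsto_nhdsWithin_iff.2 ⟨?_, ?_⟩
    · have hc : Continuous fun t : ℝ => x + t • v := by fun_prop
      simpa using (hc.tendsto 0).mono_left nhdsWithin_le_nhds
    · filter_upwards [self_mem_nhdsWithin] with t ht
      simpa [hv0] using ht
  obtain ⟨t, ht⟩ := (hline.eventually h).exists
  simp [hv] at ht

theorem DeepNet.IsStrictLocalMin.isLocalMin {S : Type*} [TopologicalSpace S] {f : S → ℝ} {x : S}
    (h : DeepNet.IsStrictLocalMin f x) : IsLocalMin f x := by
  filter_upwards [eventually_nhdsWithin_iff.1 h] with y hy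
  rcases eq_or_ne y x with rfl | hne
  · exact le_rfl
  · exact (hy hne).le

/-- At a strict local minimum of a convex function of a linear map into a space of at most the same
dimension, the convex function is minimal. -/
theorem DeepNet.IsStrictLocalMin.le_of_convexOn_comp_linearMap {V V' : Type*} [AddCommGroup V]
    [Module ℝ V] [TopologicalSpace V] [IsTopologicalAddGroup V] [ContinuousSMul ℝ V]
    [FiniteDimensional ℝ V] [AddCommGroup V'] [Module ℝ V'] [FiniteDimensional ℝ V']
    (hdim : Module.finrank ℝ V' ≤ Module.finrank ℝ V) {g : V' → ℝ}
    (hg : ConvexOn ℝ Set.univ g) {L : V →ₗ[ℝ] V'} {x : V}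
    (h : DeepNet.IsStrictLocalMin (g ∘ L) x) (z : V') : g (L x) ≤ g z := by
  have hinj := h.injective_of_comp_linearMap
  -- Injectivity gives the reverse of `hdim`, so the dimensions agree.
  have hsurj : Function.Surjective L :=
    (LinearMap.injective_iff_surjective_of_finrank_eq_finrank
      (le_antisymm (LinearMap.finrank_le_finrank_of_injective hinj) hdim)).1 hinj
  obtain ⟨y, rfl⟩ := hsurj z
  exact IsMinOn.of_isLocalMin_of_convex_univ h.isLocalMin
    (by simpa using hg.comp_linearMap L) y

/-- Injectivity of `u` keeps punctured neighbourhoods punctured. -/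
theorem DeepNet.IsStrictLocalMin.comp {S S' : Type*} [TopologicalSpace S] [TopologicalSpace S']
    {f : S' → ℝ} {u : S → S'} {x : S} (h : DeepNet.IsStrictLocalMin f (u x))
    (hu : ContinuousAt u x) (hinj : Function.Injective u) :
    DeepNet.IsStrictLocalMin (f ∘ u) x :=
  (hu.continuousWithinAt.tendsto_nhdsWithin fun _ hy => hinj.ne hy).eventually h

theorem mainTheorem2 (H N : ℕ) (d : Fin (H + 2) → ℕ) (σ : ℝ → ℝ)
    (l : Matrix (Fin (d (Fin.last (H + 1)))) (Fin N) ℝ →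
      Matrix (Fin (d (Fin.last (H + 1)))) (Fin N) ℝ → ℝ)
    (X : Matrix (Fin (d 0)) (Fin N) ℝ)
    (Y : Matrix (Fin (d (Fin.last (H + 1)))) (Fin N) ℝ)
    (hX : ∃ k, ∀ i j, i ≠ j → X k i ≠ X k j)
    (hconv : ConvexOn ℝ Set.univ (l Y)) (hcont : Continuous (l Y))
    (hwide : N ≤ d (Fin.last H).castSucc)
    (hσ : Continuous σ) :
    ¬ ∃ W : DeepNet.Weights d,
      DeepNet.IsStrictBadLocalMin (DeepNet.empiricalLoss d σ l X Y) W := by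
  rintro ⟨W, hmin, hbad⟩
  set T := DeepNet.layerOutput d σ X W (Fin.last H)
  let L : Matrix (Fin (d (Fin.last H).succ)) (Fin (d (Fin.last H).castSucc)) ℝ →ₗ[ℝ]
      Matrix (Fin (d (Fin.last (H + 1)))) (Fin N) ℝ := mulRightLinearMap _ ℝ T
  have hloss : DeepNet.empiricalLoss d σ l X Y ∘ Function.update W (Fin.last H) = l Y ∘ L :=
    funext fun R => congrArg (l Y) (networkOutput_update_last d σ X W R)
  have hstrict : DeepNet.IsStrictLocalMin (l Y ∘ L) (W (Fin.last H)) := by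
    rw [← hloss]
    refine DeepNet.IsStrictLocalMin.comp ?_ (by fun_prop) (Function.update_injective W _)
    rwa [Function.update_eq_self]
  have hdim : Module.finrank ℝ (Matrix (Fin (d (Fin.last (H + 1)))) (Fin N) ℝ) ≤
      Module.finrank ℝ
        (Matrix (Fin (d (Fin.last H).succ)) (Fin (d (Fin.last H).castSucc)) ℝ) := by
    simpa [Module.finrank_matrix] using Nat.mul_le_mul_left _ hwide
  refine hbad.not_ge (le_iInf fun W' => EReal.coe_le_coe_iff.2 ?_)
  -- The hidden layers of `W'` may differ from those of `W`: only its output matrix matters.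
  exact hstrict.le_of_convexOn_comp_linearMap hdim hconv (DeepNet.networkOutput d σ X W')
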